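/- Let $K\ge 1$, let $\mathcal K=\{1,\dots,K\}$ be a set of actions and let $G_1,G_2,\dots$ be a deterministic sequence of undirected graphs on $\mathcal K$, in each of which every action is regarded as having a self-loop. On a probability space let $p^*$ be a random probability measure on $[0,1]^K$, let $\boldsymbol Y_t=(Y_{t,a})_{a\in\mathcal K}$, $t\ge 1$, be random vectors that are, conditionally on $p^*$, independent and identically distributed with law $p^*$, and let $A^*\in\arg\max_{a\in\mathcal K}\mathbb E[Y_{t,a}\mid p^*]$ be an optimal action, chosen as a measurable function of $p^*$. (The rewards of different actions need not be independent.) In each round $t$ a decision maker plays an action $A_t$ and then observes $Y_{t,A_t}$ and $Y_{t,a}$ for every neighbour $a$ of $A_t$ in $G_t$. Let $\mathcal F_t$ be the $\sigma$-algebra generated by all actions and observed rewards of the rounds $1,\dots,t-1$. The decision maker follows a randomized policy: the conditional law of $A_t$ given $\mathcal F_t$, $p^*$ and all the vectors $(\boldsymbol Y_s)_{s\ge1}$ equals its conditional law given $\mathcal F_t$. The policy is vanilla Thompson Sampling (TS-N): for all $t\ge1$ and $a\in\mathcal K$, $$\mathbb P(A_t=a\mid\mathcal F_t)=\mathbb P(A^*=a\mid\mathcal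 F_t)\quad\text{almost surely}.$$ Let $\boldsymbol\alpha_1(a)=\mathbb P(A^*=a)$ be the prior distribution of $A^*$, let $H(\boldsymbol\alpha_1)=-\sum_{a\in\mathcal K}\boldsymbol\alpha_1(a)\log\boldsymbol\alpha_1(a)$ (natural logarithm, $0\log0=0$) be its Shannon entropy, and let $\beta_0(G)$ be the independence number of a graph $G$. Then for every $T\ge 0$ the Bayesian regret $\mathbb E[R(T)]=\mathbb E\big[\sum_{t=1}^T (Y_{t,A^*}-Y_{t,A_t})\big]$ is well defined and satisfies $$\mathbb E[R(T)]\le\sqrt{\tfrac12\sum_{t=1}^T\beta_0(G_t)\,H(\boldsymbol\alpha_1)}.$$ Moreover $H(\boldsymbol\alpha_1)\le\log K$, and consequently $$\mathbb E[R(T)]\le\sqrt{\tfrac12\,\bar\beta_0\,T\log K},\qquad \bar\beta_0=\frac1T\sum_{t=1}^T\beta_0(G_t)$$ (for $T=0$ both sides are $0$); in particular the regret is $O(\sqrt{\bar\beta_0T\log K})$ with an absolute constant. -/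

import Mathlib

open MeasureTheory ProbabilityTheory

noncomputable section

namespace GraphBandit

/-- Reward vectors: one reward in `[0,1]` for each of the `K` actions. -/
abbrev RewardVec (K : ℕ) : Type := Fin K → unitInterval

variable {Ω : Type*} [MeasurableSpace Ω] {K : ℕ}

/-- The Bayesian stochastic bandit. The reward distribution `pstar` is a random probability
measure on `[0,1]^K`, `Y t` is the reward vector of round `t` (rounds are numbered
`0, 1, 2, …`), and `Astar` is an optimal action, determined by `pstar`.
No independence between the rewards of different actions is required. -/
structure IsBayesianBandit (P : Measure Ω)
    (pstar : Ω → ProbabilityMeasure (RewardVec K)) (Y : ℕ → Ω → RewardVec K)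
    (Astar : Ω → Fin K) : Prop where
  measurable_pstar : Measurable pstar
  measurable_Y : ∀ t, Measurable (Y t)
  /-- Given `pstar`, the vectors `Y 0, Y 1, …` are independent with common law `pstar`. -/
  cond_iid : ∀ (s : Finset ℕ) (B : ℕ → Set (RewardVec K)), (∀ t ∈ s, MeasurableSet (B t)) →
    P⟦⋂ t ∈ s, Y t ⁻¹' B t | MeasurableSpace.comap pstar inferInstance⟧ =ᵐ[P]
      fun ω => ∏ t ∈ s, (pstar ω : Measure (RewardVec K)).real (B t)
  /-- The optimal action is a measurable function of `pstar`. -/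
  measurable_Astar : Measurable[MeasurableSpace.comap pstar inferInstance] Astar
  /-- `Astar` maximizes the mean reward under `pstar`. -/
  optimal : ∀ᵐ ω ∂P, ∀ a : Fin K,
    ∫ y, (y a : ℝ) ∂(pstar ω : Measure (RewardVec K)) ≤
      ∫ y, (y (Astar ω) : ℝ) ∂(pstar ω : Measure (RewardVec K))

open Classical in
/-- What the decision maker sees at the end of a round with undirected feedback graph `G` when
action `i` is played and the reward vector is `y`: the action `i`, the reward of `i` (every
action has a self-loop) and the rewards of the neighbours of `i`. Unobserved entries are masked
by `0`; as `i` is recorded, the mask carries no information. -/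
def observation (G : SimpleGraph (Fin K)) (i : Fin K) (y : RewardVec K) :
    Fin K × RewardVec K :=
  (i, fun a => if a = i ∨ G.Adj i a then y a else 0)

/-- The `σ`-algebra generated by all observations made before round `t`. -/
@[reducible] def history (G : ℕ → SimpleGraph (Fin K)) (Y : ℕ → Ω → RewardVec K) (A : ℕ → Ω → Fin K)
    (t : ℕ) : MeasurableSpace Ω :=
  ⨆ s : ℕ, ⨆ _ : s < t,
    MeasurableSpace.comap (fun ω => observation (G s) (A s ω) (Y s ω)) inferInstance

/-- The sampling distribution `π_t(a) = ℙ(A_t = a | history before round t)`. -/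
def sampling (P : Measure Ω) (G : ℕ → SimpleGraph (Fin K)) (Y : ℕ → Ω → RewardVec K)
    (A : ℕ → Ω → Fin K) (t : ℕ) (a : Fin K) : Ω → ℝ :=
  P⟦A t ⁻¹' {a} | history G Y A t⟧

/-- The posterior distribution `α_t(a) = ℙ(A* = a | history before round t)`. -/
def optPosterior (P : Measure Ω) (G : ℕ → SimpleGraph (Fin K)) (Y : ℕ → Ω → RewardVec K)
    (A : ℕ → Ω → Fin K) (Astar : Ω → Fin K) (t : ℕ) (a : Fin K) : Ω → ℝ :=
  P⟦Astar ⁻¹' {a} | history G Y A t⟧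

/-- The actions `A t` are those of a randomized policy: in each round the action is drawn from
a distribution that depends on the history only, so that the reward distribution and the reward
vectors carry no further information about the action. -/
structure IsRandomizedPolicy (P : Measure Ω) (G : ℕ → SimpleGraph (Fin K))
    (pstar : Ω → ProbabilityMeasure (RewardVec K)) (Y : ℕ → Ω → RewardVec K)
    (A : ℕ → Ω → Fin K) : Prop where
  measurable_A : ∀ t, Measurable (A t)
  nonanticipating : ∀ (t : ℕ) (a : Fin K),
    P⟦A t ⁻¹' {a} | history G Y A t ⊔ MeasurableSpace.comap pstar inferInstance ⊔
        MeasurableSpace.comap (fun ω s => Y s ω) inferInstance⟧ =ᵐ[P]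
      sampling P G Y A t a

/-- Vanilla Thompson Sampling (TS-N): the randomized policy that in every round samples its
action from the posterior distribution of the optimal action. -/
structure IsTSN (P : Measure Ω) (G : ℕ → SimpleGraph (Fin K))
    (pstar : Ω → ProbabilityMeasure (RewardVec K)) (Y : ℕ → Ω → RewardVec K)
    (Astar : Ω → Fin K) (A : ℕ → Ω → Fin K) : Prop
    extends IsRandomizedPolicy P G pstar Y A where
  sampling_eq_posterior : ∀ (t : ℕ) (a : Fin K),
    sampling P G Y A t a =ᵐ[P] optPosterior P G Y A Astar t a

/-- The regret accumulated over the first `T` rounds. -/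
def regret (Y : ℕ → Ω → RewardVec K) (Astar : Ω → Fin K) (A : ℕ → Ω → Fin K) (T : ℕ)
    (ω : Ω) : ℝ :=
  ∑ t ∈ Finset.range T, ((Y t ω (Astar ω) : ℝ) - (Y t ω (A t ω) : ℝ))

/-- The prior distribution `α₁` of the optimal action. -/
def optPrior (P : Measure Ω) (Astar : Ω → Fin K) (a : Fin K) : ℝ :=
  P.real (Astar ⁻¹' {a})

/-- Shannon entropy `-∑ p i log (p i)`, in nats, with `0 log 0 = 0`. -/
def entropy (p : Fin K → ℝ) : ℝ :=
  -∑ i, p i * Real.log (p i)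

/-- The average independence number of the first `T` feedback graphs. -/
def avgIndepNum (G : ℕ → SimpleGraph (Fin K)) (T : ℕ) : ℝ :=
  (∑ t ∈ Finset.range T, ((G t).indepNum : ℝ)) / T

end GraphBandit

end

/-!
The proof is the information-ratio argument for Thompson sampling, with conditional expectations
in place of regular conditional distributions. Fix a round, let `F` be the history before it, and
for each action `a` let `α a` be the posterior probability of `Astar = a`, `Δ a` the amount by which
learning `Astar = a` shifts the conditional mean of the reward of `a` (`meanShift`), and `q a` the
probability that the reward of `a` is revealed, i.e. the posterior mass of the closed neighbourhood
of `a`.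

Because the action is drawn from the posterior of `Astar`, independently of the rewards given the
history, the expected regret of the round is `E[∑ α Δ]` (`integral_instant_regret_eq`). By
Cauchy–Schwarz, `(∑ α Δ)² ≤ (∑ α / q) (∑ q α Δ²)`, and the first factor is at most the independence
number, by a greedy construction of an independent set (`sum_div_nbhdWeight_le_indepNum`).

The second factor is at most half the information gained about `Astar`
(`integral_mul_log_condExp_add_le`, `two_mul_integral_roundInfo_le`): this is Pinsker's inequality,
proved from Young's inequality for `x log x` with an exponential tilt, the tilt being controlled by
Hoeffding's lemma for Bernoulli variables. For each value `a` of `Astar` the tilt involves the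
reward of `a` only, on the event that it is revealed; this is why no independence between the
rewards of different actions is needed. The tilt is measurable for the history after the round,
so that the posterior density can be paired with it directly.

The information gains telescope to at most the entropy of the prior, and a last application of
Cauchy–Schwarz over the rounds gives the bound.
-/

namespace GraphBandit

/-! ### Scalar inequalities -/

/-- Young's inequality for the conjugate pair `x log x` and `exp`, relative to the reference
value `b`; it is the pointwise form of the Donsker–Varadhan bound. -/
lemma mul_one_add_log_add_sub_le {x b : ℝ} (u : ℝ) (hx : 0 ≤ x) (hb : 0 < b) :
    x * (1 + Real.log b + u) - b * Real.exp u ≤ x * Real.log x := by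
  rcases hx.eq_or_lt with rfl | hx
  · simpa using (mul_pos hb (Real.exp_pos u)).le
  · have h := Real.log_le_sub_one_of_pos (show 0 < b * Real.exp u / x by positivity)
    rw [Real.log_div (by positivity) hx.ne', Real.log_mul hb.ne' (Real.exp_pos u).ne',
      Real.log_exp] at h
    have h2 := mul_le_mul_of_nonneg_left h hx.le
    have h3 : x * (b * Real.exp u / x - 1) = b * Real.exp u - x := by field_simp
    linarith

/-- Convexity of the exponential on `[0, 1]`. -/
lemma exp_mul_le_chord (l : ℝ) {y : ℝ} (h0 : 0 ≤ y) (h1 : y ≤ 1) :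
    Real.exp (l * y) ≤ 1 - y + y * Real.exp l := by
  have h := convexOn_exp.2 (Set.mem_univ 0) (Set.mem_univ l) (sub_nonneg.2 h1) h0 (by ring)
  simpa [mul_comm] using h

/-- Hoeffding's lemma for a Bernoulli variable of mean `p`. -/
lemma one_sub_add_mul_exp_le (l : ℝ) {p : ℝ} (h0 : 0 ≤ p) (h1 : p ≤ 1) :
    1 - p + p * Real.exp l ≤ Real.exp (l * p + l ^ 2 / 8) := by
  let μ : Measure ℝ := ENNReal.ofReal (1 - p) • Measure.dirac 0 + ENNReal.ofReal p • Measure.dirac 1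
  have hint (f : ℝ → ℝ) : ∫ x, f x ∂μ = (1 - p) * f 0 + p * f 1 := by
    rw [integral_add_measure ((integrable_dirac (by simp)).smul_measure (by simp))
      ((integrable_dirac (by simp)).smul_measure (by simp))]
    simp [integral_smul_measure, ENNReal.toReal_ofReal, h0, h1]
  have : IsProbabilityMeasure μ := ⟨by
    simp only [μ, Measure.coe_add, Measure.coe_smul, Pi.add_apply, Pi.smul_apply, measure_univ,
      smul_eq_mul, mul_one]
    rw [← ENNReal.ofReal_add (by linarith) h0]; simp⟩
  have h := (hasSubgaussianMGF_of_mem_Icc (μ := μ) (X := fun x => x) (a := 0) (b := 1)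
    aemeasurable_id (by
      simp only [μ, ae_add_measure_iff]
      constructor <;> refine Measure.ae_smul_measure ?_ _ <;>
        · rw [ae_dirac_eq]; simp)).mgf_le l
  simp only [mgf, hint] at h
  have e1 : ((((‖(1:ℝ) - 0‖₊ / 2) ^ 2 : NNReal) : ℝ)) * l ^ 2 / 2 = l ^ 2 / 8 := by
    simp; ring
  rw [e1] at h
  calc 1 - p + p * Real.exp l
      = Real.exp (l * p) * ((1 - p) * Real.exp (l * (0 - ((1 - p) * 0 + p * 1)))
          + p * Real.exp (l * (1 - ((1 - p) * 0 + p * 1)))) := by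
        rw [mul_add, mul_left_comm, mul_left_comm _ p, ← Real.exp_add, ← Real.exp_add]
        ring_nf; simp only [Real.exp_zero]; ring
    _ ≤ Real.exp (l * p) * Real.exp (l ^ 2 / 8) := by gcongr
    _ = _ := by rw [← Real.exp_add]

lemma entropy_le_log_card {K : ℕ} {p : Fin K → ℝ} (h0 : ∀ i, 0 ≤ p i) (h1 : ∑ i, p i = 1) :
    entropy p ≤ Real.log K := by
  have hK : (0 : ℝ) < K := by
    rcases K.eq_zero_or_pos with rfl | h
    · simp at h1
    · exact_mod_cast h
  have h : ∀ i, p i - (K : ℝ)⁻¹ - p i * Real.log K ≤ p i * Real.log (p i) := fun i => by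
    have := mul_one_add_log_add_sub_le (x := p i) (b := (K : ℝ)⁻¹) 0 (h0 i) (by positivity)
    rw [Real.log_inv, Real.exp_zero] at this
    linarith
  have := Finset.sum_le_sum fun i (_ : i ∈ Finset.univ) => h i
  simp only [Finset.sum_sub_distrib, ← Finset.sum_mul, h1, Finset.sum_const, Finset.card_univ,
    Fintype.card_fin, nsmul_eq_mul, mul_inv_cancel₀ hK.ne'] at this
  unfold entropy
  linarith

/-! ### A weighted Caro–Wei bound for the independence number -/

open Classical in
/-- The weight of the closed neighbourhood of `a`, which consists of the actions whose play reveals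
the reward of `a`. -/
noncomputable def nbhdWeight {K : ℕ} (G : SimpleGraph (Fin K)) (w : Fin K → ℝ) (a : Fin K) : ℝ :=
  ∑ i, if a = i ∨ G.Adj i a then w i else 0

lemma le_nbhdWeight {K : ℕ} (G : SimpleGraph (Fin K)) {w : Fin K → ℝ} (hw : ∀ i, 0 ≤ w i)
    {a i : Fin K} (h : a = i ∨ G.Adj i a) : w i ≤ nbhdWeight G w a := by
  classical
  refine le_trans (by simp [h])
    (Finset.single_le_sum (f := fun i => if a = i ∨ G.Adj i a then w i else 0) (fun j _ => ?_)
      (Finset.mem_univ i))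
  split_ifs
  exacts [hw j, le_rfl]

/-- Greedy construction: repeatedly pick a vertex whose closed neighbourhood is lightest and delete
that neighbourhood, which accounts for at most `1` in the sum. -/
lemma exists_isIndepSet_sum_div_le {K : ℕ} (G : SimpleGraph (Fin K)) {w : Fin K → ℝ}
    (hw : ∀ i, 0 ≤ w i) (S : Finset (Fin K)) :
    ∃ I ⊆ S, G.IsIndepSet (I : Set (Fin K)) ∧
      ∑ a ∈ S, w a / nbhdWeight G w a ≤ (I.card : ℝ) := by
  classical
  induction S using Finset.strongInduction with
  | H S ih =>
    rcases S.eq_empty_or_nonempty with rfl | hS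
    · exact ⟨∅, by simp⟩
    obtain ⟨a, haS, hmin⟩ := S.exists_min_image (nbhdWeight G w) hS
    let N : Fin K → Prop := fun i => a = i ∨ G.Adj i a
    obtain ⟨I, hIS, hI, hsum⟩ := ih (S.filter (¬ N ·)) <| by
      refine Finset.filter_ssubset.2 ⟨a, haS, ?_⟩
      simp [N]
    have haI : a ∉ I := fun h => by simpa [N] using hIS h
    refine ⟨insert a I, Finset.insert_subset haS (hIS.trans (Finset.filter_subset _ _)), ?_, ?_⟩
    · rw [Finset.coe_insert, SimpleGraph.isIndepSet_iff, Set.pairwise_insert]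
      have key : ∀ b ∈ I, ¬G.Adj a b := fun b hb hab => by
        have := hIS hb
        simp only [Finset.mem_filter, N, not_or] at this
        exact this.2.2 hab.symm
      exact ⟨hI, fun b hb _ => ⟨key b hb, fun h => key b hb h.symm⟩⟩
    · have h1 : ∑ b ∈ S.filter N, w b / nbhdWeight G w b ≤ 1 := by
        have hq : 0 ≤ nbhdWeight G w a := (hw a).trans (le_nbhdWeight G hw (Or.inl rfl))
        calc ∑ b ∈ S.filter N, w b / nbhdWeight G w b
            ≤ ∑ b ∈ S.filter N, w b / nbhdWeight G w a := by
              refine Finset.sum_le_sum fun b hb => ?_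
              obtain ⟨hbS, hbN⟩ := Finset.mem_filter.1 hb
              rcases hq.eq_or_lt with h | h
              · have : w b = 0 := le_antisymm (h ▸ le_nbhdWeight G hw hbN) (hw b)
                simp [this]
              · exact div_le_div_of_nonneg_left (hw b) h (hmin b hbS)
          _ ≤ ∑ b ∈ Finset.univ.filter N, w b / nbhdWeight G w a :=
              Finset.sum_le_sum_of_subset_of_nonneg
                (Finset.filter_subset_filter _ (Finset.subset_univ S))
                fun b _ _ => div_nonneg (hw b) hq
          _ = nbhdWeight G w a / nbhdWeight G w a := by
              rw [← Finset.sum_div, Finset.sum_filter, nbhdWeight]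
          _ ≤ 1 := div_self_le_one _
      rw [Finset.card_insert_of_notMem haI, ← Finset.sum_filter_add_sum_filter_not S N]
      push_cast
      linarith

lemma sum_div_nbhdWeight_le_indepNum {K : ℕ} (G : SimpleGraph (Fin K)) {w : Fin K → ℝ}
    (hw : ∀ i, 0 ≤ w i) : ∑ a, w a / nbhdWeight G w a ≤ (G.indepNum : ℝ) := by
  obtain ⟨I, -, hI, h⟩ := exists_isIndepSet_sum_div_le G hw Finset.univ
  exact h.trans (by exact_mod_cast hI.card_le_indepNum)

/-- Cauchy–Schwarz with the weights `w / nbhdWeight`, whose total is at most the independence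
number. -/
lemma sq_sum_mul_le_indepNum_mul {K : ℕ} (G : SimpleGraph (Fin K)) {w : Fin K → ℝ}
    (hw : ∀ i, 0 ≤ w i) (d : Fin K → ℝ) :
    (∑ a, w a * d a) ^ 2 ≤
      (G.indepNum : ℝ) * ∑ a, nbhdWeight G w a * w a * d a ^ 2 := by
  have hq : ∀ a, w a ≤ nbhdWeight G w a := fun a => le_nbhdWeight G hw (Or.inl rfl)
  have hq0 : ∀ a, 0 ≤ nbhdWeight G w a := fun a => (hw a).trans (hq a)
  have hg : ∀ a, 0 ≤ nbhdWeight G w a * w a * d a ^ 2 := fun a =>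
    mul_nonneg (mul_nonneg (hq0 a) (hw a)) (sq_nonneg _)
  refine (Finset.sum_sq_le_sum_mul_sum_of_sq_le_mul Finset.univ
    (f := fun a => w a / nbhdWeight G w a) (fun a _ => div_nonneg (hw a) (hq0 a))
    (fun a _ => hg a) fun a _ => ?_).trans
    (mul_le_mul_of_nonneg_right (sum_div_nbhdWeight_le_indepNum G hw)
      (Finset.sum_nonneg fun a _ => hg a))
  rcases (hq0 a).eq_or_lt with h | h
  · have : w a = 0 := le_antisymm (h ▸ hq a) (hw a)
    simp [this]
  · refine le_of_eq ?_
    field_simp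

/-! ### Essentially bounded functions -/

variable {Ω : Type*} {m m' m0 : MeasurableSpace Ω} {P : Measure Ω} {f g : Ω → ℝ}

/-- `f` is measurable for the `σ`-algebra `m` and bounded off a `P`-null set. -/
structure EssBdd (m : MeasurableSpace Ω) {m0 : MeasurableSpace Ω} (P : Measure Ω) (f : Ω → ℝ) :
    Prop where
  meas : StronglyMeasurable[m] f
  bdd : ∃ C, ∀ᵐ ω ∂P, |f ω| ≤ C

namespace EssBdd

lemma const (m : MeasurableSpace Ω) {m0 : MeasurableSpace Ω} (P : Measure Ω) (c : ℝ) :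
    EssBdd m P fun _ => c :=
  ⟨stronglyMeasurable_const, |c|, by simp⟩

lemma of_mem_Icc {C : ℝ} (hf : StronglyMeasurable[m] f) (h0 : ∀ ω, 0 ≤ f ω) (h1 : ∀ ω, f ω ≤ C) :
    EssBdd m P f :=
  ⟨hf, C, .of_forall fun ω => by rw [abs_of_nonneg (h0 ω)]; exact h1 ω⟩

lemma mono (hm : m ≤ m') (hf : EssBdd m P f) : EssBdd m' P f := ⟨hf.meas.mono hm, hf.bdd⟩

lemma add (hf : EssBdd m P f) (hg : EssBdd m P g) : EssBdd m P fun ω => f ω + g ω := by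
  obtain ⟨C, hC⟩ := hf.bdd
  obtain ⟨D, hD⟩ := hg.bdd
  refine ⟨hf.meas.add hg.meas, C + D, ?_⟩
  filter_upwards [hC, hD] with ω h1 h2 using (abs_add_le _ _).trans (add_le_add h1 h2)

lemma mul (hf : EssBdd m P f) (hg : EssBdd m P g) : EssBdd m P fun ω => f ω * g ω := by
  obtain ⟨C, hC⟩ := hf.bdd
  obtain ⟨D, hD⟩ := hg.bdd
  refine ⟨hf.meas.mul hg.meas, C * D, ?_⟩
  filter_upwards [hC, hD] with ω h1 h2
  rw [abs_mul]
  exact mul_le_mul h1 h2 (abs_nonneg _) ((abs_nonneg _).trans h1)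

lemma const_mul (c : ℝ) (hf : EssBdd m P f) : EssBdd m P fun ω => c * f ω :=
  (const m P c).mul hf

lemma sub (hf : EssBdd m P f) (hg : EssBdd m P g) : EssBdd m P fun ω => f ω - g ω := by
  simpa [sub_eq_add_neg] using hf.add (hg.const_mul (-1))

lemma sum {ι : Type*} {s : Finset ι} {f : ι → Ω → ℝ} (hf : ∀ i ∈ s, EssBdd m P (f i)) :
    EssBdd m P fun ω => ∑ i ∈ s, f i ω := by
  classical
  induction s using Finset.induction_on with
  | empty => simpa using const m P 0
  | insert a s ha ih =>
    simp only [Finset.sum_insert ha]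
    exact (hf a (by simp)).add (ih fun i hi => hf i (by simp [hi]))

lemma comp {φ : ℝ → ℝ} (hφ : Continuous φ) (hf : EssBdd m P f) : EssBdd m P fun ω => φ (f ω) := by
  obtain ⟨C, hC⟩ := hf.bdd
  obtain ⟨D, hD⟩ := (isCompact_Icc (a := -C) (b := C)).exists_bound_of_continuousOn hφ.continuousOn
  refine ⟨hφ.comp_stronglyMeasurable hf.meas, D, ?_⟩
  filter_upwards [hC] with ω h using hD _ (abs_le.1 h)

lemma integrable [IsFiniteMeasure P] (hm : m ≤ m0) (hf : EssBdd m P f) : Integrable f P := by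
  obtain ⟨C, hC⟩ := hf.bdd
  exact Integrable.of_bound (hf.meas.mono hm).aestronglyMeasurable C hC

lemma condExp (hf : EssBdd m' P f) : EssBdd m P (P[f|m]) := by
  obtain ⟨C, hC⟩ := hf.bdd
  refine ⟨stronglyMeasurable_condExp, C, ?_⟩
  exact ae_bdd_abs_condExp_of_ae_bdd_abs hC

/-- Conditional expectation is self-adjoint: a factor that is already `m`-measurable does not see
the difference between `g` and its conditional expectation. -/
lemma integral_mul_condExp [IsFiniteMeasure P] (hm : m ≤ m0) (hm' : m' ≤ m0) (hf : EssBdd m P f)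
    (hg : EssBdd m' P g) : ∫ ω, f ω * (P[g|m]) ω ∂P = ∫ ω, f ω * g ω ∂P := by
  have h := condExp_mul_of_stronglyMeasurable_left hf.meas
    (((hf.mono hm).mul (hg.mono hm')).integrable le_rfl) (hg.integrable hm')
  rw [← integral_condExp hm (f := fun ω => f ω * g ω)]
  exact (integral_congr_ae h).symm

end EssBdd

end GraphBandit

namespace GraphBandit

variable {Ω : Type*} {F F' M m0 : MeasurableSpace Ω} {P : Measure Ω} {V Y B q : Ω → ℝ}

/-! ### Information gained about an event in one round -/

/-- If `V` is the indicator of an event, this is `E[Y | F, V] - E[Y | F]`: the amount by which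
learning the event shifts the conditional mean of `Y`. It is `0` where the event has conditional
probability `0`. -/
noncomputable def meanShift (F : MeasurableSpace Ω) {m0 : MeasurableSpace Ω} (P : Measure Ω)
    (V Y : Ω → ℝ) (ω : Ω) : ℝ :=
  ((P[fun ω => V ω * Y ω|F]) ω - (P[V|F]) ω * (P[Y|F]) ω) / (P[V|F]) ω

/-- A factor `B` whose conditional expectation given the larger `σ`-algebra `M` is already
`F`-measurable is conditionally uncorrelated, given `F`, with every `M`-measurable `X`. -/
lemma integral_mul_mul_of_condExp_eq [IsFiniteMeasure P] {X Z : Ω → ℝ} (hFM : F ≤ M) (hM : M ≤ m0)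
    (hB : EssBdd m0 P B) (hq : EssBdd F P q) (hBq : P[B|M] =ᵐ[P] q) (hZ : EssBdd F P Z)
    (hX : EssBdd M P X) :
    ∫ ω, Z ω * (B ω * X ω) ∂P = ∫ ω, Z ω * q ω * (P[X|F]) ω ∂P := by
  rw [(hZ.mul hq).integral_mul_condExp (hFM.trans hM) hM hX]
  calc ∫ ω, Z ω * (B ω * X ω) ∂P = ∫ ω, (Z ω * X ω) * B ω ∂P := by
        congr 1; ext ω; ring
    _ = ∫ ω, (Z ω * X ω) * (P[B|M]) ω ∂P :=
        (((hZ.mono hFM).mul hX).integral_mul_condExp hM le_rfl hB).symm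
    _ = ∫ ω, Z ω * q ω * X ω ∂P := by
        refine integral_congr_ae ?_
        filter_upwards [hBq] with ω h
        rw [h]; ring

lemma condExp_mem_Icc [IsProbabilityMeasure P] {X : Ω → ℝ} (hF : F ≤ m0) (hX : Integrable X P)
    (h0 : ∀ ω, 0 ≤ X ω) (h1 : ∀ ω, X ω ≤ 1) :
    ∀ᵐ ω ∂P, 0 ≤ (P[X|F]) ω ∧ (P[X|F]) ω ≤ 1 := by
  have h2 := condExp_mono (m := F) hX (integrable_const (1 : ℝ)) (.of_forall h1)
  rw [condExp_const hF] at h2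
  filter_upwards [condExp_nonneg (m := F) (.of_forall h0), h2] with ω a b using ⟨a, b⟩

lemma abs_condExp_mul_sub_le [IsProbabilityMeasure P] (hF : F ≤ m0)
    (hV : EssBdd m0 P V) (hV0 : ∀ ω, 0 ≤ V ω)
    (hY : EssBdd m0 P Y) (hY0 : ∀ ω, 0 ≤ Y ω) (hY1 : ∀ ω, Y ω ≤ 1) :
    ∀ᵐ ω ∂P, |(P[fun ω => V ω * Y ω|F]) ω - (P[V|F]) ω * (P[Y|F]) ω| ≤ (P[V|F]) ω := by
  have h1 := condExp_mono (m := F) ((hV.mul hY).integrable le_rfl) (hV.integrable le_rfl)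
    (.of_forall fun ω => mul_le_of_le_one_right (hV0 ω) (hY1 ω))
  have h2 := condExp_nonneg (μ := P) (m := F) (f := fun ω => V ω * Y ω)
    (.of_forall fun ω => mul_nonneg (hV0 ω) (hY0 ω))
  filter_upwards [h1, h2, condExp_mem_Icc hF (hY.integrable le_rfl) hY0 hY1,
    condExp_nonneg (m := F) (.of_forall hV0)] with ω a b c d
  simp only [Pi.zero_apply] at a b d
  rw [abs_le]
  constructor <;> nlinarith [mul_nonneg d c.1, mul_le_of_le_one_right d c.2]

lemma condExp_mul_meanShift [IsProbabilityMeasure P] (hF : F ≤ m0)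
    (hV : EssBdd m0 P V) (hV0 : ∀ ω, 0 ≤ V ω)
    (hY : EssBdd m0 P Y) (hY0 : ∀ ω, 0 ≤ Y ω) (hY1 : ∀ ω, Y ω ≤ 1) :
    ∀ᵐ ω ∂P, (P[V|F]) ω * meanShift F P V Y ω =
      (P[fun ω => V ω * Y ω|F]) ω - (P[V|F]) ω * (P[Y|F]) ω := by
  filter_upwards [abs_condExp_mul_sub_le hF hV hV0 hY hY0 hY1] with ω h
  by_cases h0 : (P[V|F]) ω = 0
  · rw [h0, abs_nonpos_iff] at h
    rw [h0, h, zero_mul]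
  · rw [meanShift, mul_div_cancel₀ _ h0]

lemma essBdd_meanShift [IsProbabilityMeasure P] (hF : F ≤ m0)
    (hV : EssBdd m0 P V) (hV0 : ∀ ω, 0 ≤ V ω)
    (hY : EssBdd m0 P Y) (hY0 : ∀ ω, 0 ≤ Y ω) (hY1 : ∀ ω, Y ω ≤ 1) :
    EssBdd F P (meanShift F P V Y) := by
  refine ⟨?_, 1, ?_⟩
  · exact (((hV.mul hY).condExp.sub (hV.condExp.mul hY.condExp)).meas.measurable.div
      (hV.condExp (m := F)).meas.measurable).stronglyMeasurable
  · filter_upwards [abs_condExp_mul_sub_le hF hV hV0 hY hY0 hY1] with ω h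
    rw [meanShift, abs_div]
    exact div_le_one_of_le₀ (h.trans (le_abs_self _)) (abs_nonneg _)

/-- Suppose that between the `σ`-algebras `F` and `F'` the variable `Y ∈ [0, 1]` is revealed on the
event `B`, whose probability `q` given all of `M` depends on `F` only. Then the expected value of
`x log x` at the conditional probability of the event `V` grows by at least `2 E[q α Δ²]`, where
`α` is the conditional probability of `V` given `F` and `Δ` the shift of the conditional mean
of `Y`. This is Pinsker's inequality for the pair (law of `Y` given `V`, law of `Y`), obtained
from the variational bound with the exponential tilt `4Δ(Y - E[Y|F]) - 2Δ²` on `B`. -/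
theorem integral_mul_log_condExp_add_le [IsProbabilityMeasure P] (hFF' : F ≤ F') (hF' : F' ≤ m0)
    (hFM : F ≤ M) (hM : M ≤ m0)
    (hV : EssBdd M P V) (hV0 : ∀ ω, 0 ≤ V ω)
    (hY : EssBdd M P Y) (hY0 : ∀ ω, 0 ≤ Y ω) (hY1 : ∀ ω, Y ω ≤ 1)
    (hB : EssBdd F' P B) (hB01 : ∀ ω, B ω = 0 ∨ B ω = 1)
    (hBY : EssBdd F' P fun ω => B ω * Y ω)
    (hq : EssBdd F P q) (hBq : P[B|M] =ᵐ[P] q) :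
    ∫ ω, (P[V|F]) ω * Real.log ((P[V|F]) ω) ∂P +
        2 * ∫ ω, q ω * (P[V|F]) ω * meanShift F P V Y ω ^ 2 ∂P ≤
      ∫ ω, (P[V|F']) ω * Real.log ((P[V|F']) ω) ∂P := by
  have hF : F ≤ m0 := hFM.trans hM
  have hVm := hV.mono hM
  have hYm := hY.mono hM
  have hΔ := essBdd_meanShift hF hVm hV0 hYm hY0 hY1
  have hαΔ := condExp_mul_meanShift hF hVm hV0 hYm hY0 hY1
  have hBm := hB.mono hF'
  have hq0 : 0 ≤ᵐ[P] q := by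
    have : 0 ≤ᵐ[P] P[B|M] := condExp_nonneg (.of_forall fun ω => by
      rcases hB01 ω with h | h <;> simp [h])
    exact this.trans hBq.le
  have hα : EssBdd F P (P[V|F]) := hVm.condExp
  have hα' : EssBdd F' P (P[V|F']) := hVm.condExp
  have hm : EssBdd F P (P[Y|F]) := hYm.condExp
  have hr : EssBdd F P (P[fun ω => V ω * Y ω|F]) := (hVm.mul hYm).condExp
  have hα0 : 0 ≤ᵐ[P] P[V|F] := condExp_nonneg (.of_forall hV0)
  have hα'0 : 0 ≤ᵐ[P] P[V|F'] := condExp_nonneg (.of_forall hV0)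
  have hm01 := condExp_mem_Icc hF (hYm.integrable le_rfl) hY0 hY1
  have hlog : EssBdd F P fun ω => (P[V|F]) ω * Real.log ((P[V|F]) ω) :=
    hα.comp Real.continuous_mul_log
  have hlog' : EssBdd F' P fun ω => (P[V|F']) ω * Real.log ((P[V|F']) ω) :=
    hα'.comp Real.continuous_mul_log
  have hS : EssBdd F P fun ω => q ω * (P[V|F]) ω * meanShift F P V Y ω ^ 2 :=
    (hq.mul hα).mul (hΔ.comp (φ := fun x => x ^ 2) (by fun_prop))
  refine le_of_forall_pos_le_add fun ε hε => ?_
  -- The reference value is kept away from `0`, so that its logarithm is bounded.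
  set b : Ω → ℝ := fun ω => max ((P[V|F]) ω) ε with hb_def
  set l : Ω → ℝ := fun ω => 4 * meanShift F P V Y ω with hl_def
  set c : Ω → ℝ := fun ω => l ω * (P[Y|F]) ω + l ω ^ 2 / 8 with hc_def
  have hb : EssBdd F P b := hα.comp (φ := fun x => max x ε) (by fun_prop)
  have hb0 : ∀ ω, 0 < b ω := fun ω => lt_max_of_lt_right hε
  have hlb : EssBdd F P fun ω => 1 + Real.log (b ω) :=
    hα.comp (φ := fun x => 1 + Real.log (max x ε))
      (continuous_const.add ((by fun_prop : Continuous fun x : ℝ => max x ε).log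
        fun x => (lt_max_of_lt_right hε).ne'))
  have hl : EssBdd F P l := hΔ.const_mul 4
  have hc : EssBdd F P c := (hl.mul hm).add (hl.comp (φ := fun x => x ^ 2 / 8) (by fun_prop))
  have hec : EssBdd F P fun ω => b ω * Real.exp (-c ω) :=
    hb.mul (hc.comp (φ := fun x => Real.exp (-x)) (by fun_prop))
  have hZ1 : EssBdd F P fun ω => b ω - b ω * Real.exp (-c ω) := hb.sub hec
  have hZ2 : EssBdd F P fun ω => b ω * Real.exp (-c ω) * (Real.exp (l ω) - 1) :=
    hec.mul (hl.comp (φ := fun x => Real.exp x - 1) (by fun_prop))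
  have h1M : EssBdd M P fun _ => (1 : ℝ) := EssBdd.const M P 1
  set W : Ω → ℝ := fun ω => (1 + Real.log (b ω)) + (l ω * (B ω * Y ω) - c ω * B ω) with hW_def
  have hW : EssBdd F' P W :=
    (hlb.mono hFF').add (((hl.mono hFF').mul hBY).sub ((hc.mono hFF').mul hB))
  -- The tilted lower bound for `x log x`, with the exponential replaced by its chord.
  have step1 : ∫ ω, (W ω * (P[V|F']) ω - b ω + (b ω - b ω * Real.exp (-c ω)) * (B ω * 1)
        - b ω * Real.exp (-c ω) * (Real.exp (l ω) - 1) * (B ω * Y ω)) ∂P ≤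
      ∫ ω, (P[V|F']) ω * Real.log ((P[V|F']) ω) ∂P := by
    refine integral_mono_ae ?_ (hlog'.integrable hF') ?_
    · exact (((((hW.mul hα').sub (hb.mono hFF')).add ((hZ1.mono hFF').mul
        (hB.mul (EssBdd.const F' P 1)))).sub ((hZ2.mono hFF').mul hBY))).integrable hF'
    · filter_upwards [hα'0] with ω h0
      have hy := mul_one_add_log_add_sub_le (l ω * (B ω * Y ω) - c ω * B ω) h0 (hb0 ω)
      refine le_trans (le_of_eq_of_le ?_ (sub_le_sub_left (mul_le_mul_of_nonneg_left
        (show Real.exp (l ω * (B ω * Y ω) - c ω * B ω) ≤ 1 - (1 - Real.exp (-c ω)) * B ω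
          + Real.exp (-c ω) * (Real.exp (l ω) - 1) * (B ω * Y ω) from ?_) (hb0 ω).le) _)) hy
      · simp only [hW_def]; ring
      · rcases hB01 ω with h | h
        · simp [h]
        · rw [h, one_mul, mul_one, sub_eq_neg_add, Real.exp_add]
          have := mul_le_mul_of_nonneg_left (exp_mul_le_chord (l ω) (hY0 ω) (hY1 ω))
            (Real.exp_pos (-c ω)).le
          linarith
  -- Averaging over `B` and `Y` given `F`.
  have step2 : ∫ ω, (W ω * (P[V|F']) ω - b ω + (b ω - b ω * Real.exp (-c ω)) * (B ω * 1)
        - b ω * Real.exp (-c ω) * (Real.exp (l ω) - 1) * (B ω * Y ω)) ∂P =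
      ∫ ω, ((1 + Real.log (b ω)) * (P[V|F]) ω
        + (l ω * q ω * (P[fun ω => V ω * Y ω|F]) ω - c ω * q ω * (P[V|F]) ω) - b ω
        + (b ω - b ω * Real.exp (-c ω)) * q ω * (P[fun _ => (1 : ℝ)|F]) ω
        - b ω * Real.exp (-c ω) * (Real.exp (l ω) - 1) * q ω * (P[Y|F]) ω) ∂P := by
    have e1 : ∫ ω, W ω * (P[V|F']) ω ∂P = ∫ ω, (1 + Real.log (b ω)) * (P[V|F]) ω ∂P
        + (∫ ω, l ω * q ω * (P[fun ω => V ω * Y ω|F]) ω ∂P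
          - ∫ ω, c ω * q ω * (P[V|F]) ω ∂P) := by
      rw [hW.integral_mul_condExp hF' hM hV, hlb.integral_mul_condExp hF hM hV,
        ← integral_mul_mul_of_condExp_eq hFM hM hBm hq hBq hl (hV.mul hY),
        ← integral_mul_mul_of_condExp_eq hFM hM hBm hq hBq hc hV]
      have i1 := ((hl.mono hF).mul (hBm.mul (hVm.mul hYm))).integrable le_rfl
      have i2 := ((hc.mono hF).mul (hBm.mul hVm)).integrable le_rfl
      rw [← integral_sub i1 i2,
        ← integral_add (((hlb.mono hF).mul hVm).integrable le_rfl) (by exact i1.sub i2)]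
      congr 1; ext ω; simp only [hW_def]; ring
    have hone : EssBdd F P (P[fun _ => (1 : ℝ)|F]) := (EssBdd.const M P 1).condExp
    have i1 := (hW.mul hα').integrable hF'
    have i2 := hb.integrable hF
    have i3 := ((hZ1.mono hF).mul (hBm.mul (EssBdd.const m0 P 1))).integrable le_rfl
    have i4 := ((hZ2.mono hF).mul (hBm.mul hYm)).integrable le_rfl
    have j1 := (hlb.mul hα).integrable hF
    have j2 := ((hl.mul hq).mul hr).integrable hF
    have j3 := ((hc.mul hq).mul hα).integrable hF
    have j4 := ((hZ1.mul hq).mul hone).integrable hF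
    have j5 := ((hZ2.mul hq).mul hm).integrable hF
    rw [integral_sub (by exact (i1.sub i2).add i3) i4, integral_add (by exact i1.sub i2) i3,
      integral_sub i1 i2, integral_sub (by exact ((j1.add (j2.sub j3)).sub i2).add j4) j5,
      integral_add (by exact (j1.add (j2.sub j3)).sub i2) j4,
      integral_sub (by exact j1.add (j2.sub j3)) i2, integral_add j1 (by exact j2.sub j3),
      integral_sub j2 j3, e1, integral_mul_mul_of_condExp_eq hFM hM hBm hq hBq hZ1 h1M,
      integral_mul_mul_of_condExp_eq hFM hM hBm hq hBq hZ2 hY]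
  -- Hoeffding's lemma makes the exponential terms harmless.
  have step3 : ∫ ω, ((P[V|F]) ω * Real.log ((P[V|F]) ω)
        + 2 * (q ω * (P[V|F]) ω * meanShift F P V Y ω ^ 2) - ε) ∂P ≤
      ∫ ω, ((1 + Real.log (b ω)) * (P[V|F]) ω
        + (l ω * q ω * (P[fun ω => V ω * Y ω|F]) ω - c ω * q ω * (P[V|F]) ω) - b ω
        + (b ω - b ω * Real.exp (-c ω)) * q ω * (P[fun _ => (1 : ℝ)|F]) ω
        - b ω * Real.exp (-c ω) * (Real.exp (l ω) - 1) * q ω * (P[Y|F]) ω) ∂P := by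
    have hone : EssBdd F P (P[fun _ => (1 : ℝ)|F]) := (EssBdd.const M P 1).condExp
    refine integral_mono_ae (((hlog.add (hS.const_mul 2)).sub (EssBdd.const F P ε)).integrable hF)
      ((((((hlb.mul hα).add (((hl.mul hq).mul hr).sub ((hc.mul hq).mul hα))).sub hb).add
        ((hZ1.mul hq).mul hone)).sub ((hZ2.mul hq).mul hm)).integrable hF) ?_
    rw [condExp_const hF]
    filter_upwards [hα0, hq0, hm01, hαΔ] with ω a0 q0 m01 hD
    simp only [Pi.zero_apply] at a0 q0
    have k1 : (P[V|F]) ω * Real.log ((P[V|F]) ω) ≤ (P[V|F]) ω * Real.log (b ω) := by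
      rcases a0.eq_or_lt with h | h
      · simp [← h]
      · exact mul_le_mul_of_nonneg_left (Real.log_le_log h (le_max_left _ _)) a0
    have k2 : b ω ≤ (P[V|F]) ω + ε := max_le (by linarith) (by linarith)
    have k3 : Real.exp (-c ω) * (1 - (P[Y|F]) ω + (P[Y|F]) ω * Real.exp (l ω)) ≤ 1 := by
      calc _ ≤ Real.exp (-c ω) * Real.exp (c ω) :=
            mul_le_mul_of_nonneg_left (one_sub_add_mul_exp_le (l ω) m01.1 m01.2) (Real.exp_pos _).le
        _ = 1 := by rw [← Real.exp_add]; simp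
    have k4 := mul_nonneg (mul_nonneg (hb0 ω).le q0) (sub_nonneg.2 k3)
    have k5 : l ω * q ω * (P[fun ω => V ω * Y ω|F]) ω - c ω * q ω * (P[V|F]) ω =
        2 * (q ω * (P[V|F]) ω * meanShift F P V Y ω ^ 2) := by
      rw [show (P[fun ω => V ω * Y ω|F]) ω = (P[V|F]) ω * meanShift F P V Y ω
        + (P[V|F]) ω * (P[Y|F]) ω by linarith]
      simp only [hc_def, hl_def]
      ring
    rw [k5]
    linarith
  have e3 : ∫ ω, ((P[V|F]) ω * Real.log ((P[V|F]) ω)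
        + 2 * (q ω * (P[V|F]) ω * meanShift F P V Y ω ^ 2) - ε) ∂P =
      ∫ ω, (P[V|F]) ω * Real.log ((P[V|F]) ω) ∂P +
        2 * ∫ ω, q ω * (P[V|F]) ω * meanShift F P V Y ω ^ 2 ∂P - ε := by
    rw [integral_sub (by exact (hlog.add (hS.const_mul 2)).integrable hF) (integrable_const _),
      integral_add (hlog.integrable hF) (by exact (hS.const_mul 2).integrable hF),
      integral_const_mul]
    simp
  linarith

end GraphBandit

namespace GraphBandit

/-! ### One round of the bandit -/

variable {Ω : Type*} {K : ℕ} {G : ℕ → SimpleGraph (Fin K)}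
  {pstar : Ω → ProbabilityMeasure (RewardVec K)} {Y : ℕ → Ω → RewardVec K} {Astar : Ω → Fin K}
  {A : ℕ → Ω → Fin K}

/-- Everything that is determined before the action of round `t` is drawn: the history, the reward
distribution and all reward vectors. -/
@[reducible] noncomputable def environment (G : ℕ → SimpleGraph (Fin K))
    (pstar : Ω → ProbabilityMeasure (RewardVec K)) (Y : ℕ → Ω → RewardVec K) (A : ℕ → Ω → Fin K)
    (t : ℕ) : MeasurableSpace Ω :=
  history G Y A t ⊔ MeasurableSpace.comap pstar inferInstance ⊔
    MeasurableSpace.comap (fun ω s => Y s ω) inferInstance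

/-- The reward of action `a` in round `t`, as a real random variable. -/
def reward (Y : ℕ → Ω → RewardVec K) (t : ℕ) (a : Fin K) (ω : Ω) : ℝ := Y t ω a

/-- The indicator of the event `X = a`. -/
noncomputable def eventInd (X : Ω → Fin K) (a : Fin K) : Ω → ℝ :=
  (X ⁻¹' {a}).indicator fun _ => 1

open Classical in
lemma eventInd_apply (X : Ω → Fin K) (a : Fin K) (ω : Ω) :
    eventInd X a ω = if X ω = a then 1 else 0 := by
  simp [eventInd, Set.indicator_apply]

lemma sum_eventInd_mul (X : Ω → Fin K) (f : Fin K → ℝ) (ω : Ω) :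
    ∑ a, eventInd X a ω * f a = f (X ω) := by
  classical simp [eventInd_apply]

lemma eventInd_nonneg (X : Ω → Fin K) (a : Fin K) (ω : Ω) : 0 ≤ eventInd X a ω := by
  classical
  rw [eventInd_apply]; split_ifs <;> simp

lemma eventInd_le_one (X : Ω → Fin K) (a : Fin K) (ω : Ω) : eventInd X a ω ≤ 1 := by
  classical
  rw [eventInd_apply]; split_ifs <;> simp

open Classical in
/-- The indicator that the reward of `a` is revealed when the played action is `X`. -/
noncomputable def revealInd (G : SimpleGraph (Fin K)) (X : Ω → Fin K) (a : Fin K) (ω : Ω) : ℝ :=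
  if a = X ω ∨ G.Adj (X ω) a then 1 else 0

lemma revealInd_eq_nbhdWeight (G : SimpleGraph (Fin K)) (X : Ω → Fin K) (a : Fin K) (ω : Ω) :
    revealInd G X a ω = nbhdWeight G (fun i => eventInd X i ω) a := by
  classical
  have := sum_eventInd_mul X (fun i => if a = i ∨ G.Adj i a then (1 : ℝ) else 0) ω
  rw [revealInd, nbhdWeight, ← this]
  simp

lemma history_le_succ (t : ℕ) : history G Y A t ≤ history G Y A (t + 1) :=
  iSup₂_le fun s hs => le_iSup₂_of_le s (hs.trans t.lt_succ_self) le_rfl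

lemma history_zero : history G Y A 0 = ⊥ := by simp [history]

lemma measurable_observation_history (t : ℕ) :
    Measurable[history G Y A (t + 1)] fun ω => observation (G t) (A t ω) (Y t ω) :=
  measurable_iff_comap_le.2 (le_iSup₂_of_le t t.lt_succ_self le_rfl)

lemma history_le_environment (t : ℕ) : history G Y A t ≤ environment G pstar Y A t :=
  le_sup_of_le_left le_sup_left

variable [MeasurableSpace Ω] {P : Measure Ω}

lemma essBdd_eventInd {m : MeasurableSpace Ω} {X : Ω → Fin K} (hX : Measurable[m] X) (a : Fin K) :
    EssBdd m P (eventInd X a) :=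
  .of_mem_Icc (stronglyMeasurable_const.indicator (hX (measurableSet_singleton a)))
    (eventInd_nonneg X a) (eventInd_le_one X a)

lemma essBdd_nbhdWeight {m : MeasurableSpace Ω} (G : SimpleGraph (Fin K)) {w : Fin K → Ω → ℝ}
    (hw : ∀ i, EssBdd m P (w i)) (a : Fin K) :
    EssBdd m P fun ω => nbhdWeight G (fun i => w i ω) a := by
  classical
  refine EssBdd.sum fun i _ => ?_
  by_cases h : a = i ∨ G.Adj i a
  · simpa [h] using hw i
  · simpa [h] using EssBdd.const m P 0

lemma condExp_nbhdWeight [IsFiniteMeasure P] {m : MeasurableSpace Ω} (G : SimpleGraph (Fin K))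
    {w : Fin K → Ω → ℝ} (hw : ∀ i, Integrable (w i) P) (a : Fin K) :
    P[fun ω => nbhdWeight G (fun i => w i ω) a|m] =ᵐ[P]
      fun ω => nbhdWeight G (fun i => (P[w i|m]) ω) a := by
  classical
  have e : (fun ω => nbhdWeight G (fun i => w i ω) a) =
      ∑ i ∈ Finset.univ.filter (fun i => a = i ∨ G.Adj i a), w i := by
    ext ω; simp [nbhdWeight, Finset.sum_filter]
  rw [e]
  refine (condExp_finsetSum (fun i _ => hw i) m).trans (.of_forall fun ω => ?_)
  simp [nbhdWeight, Finset.sum_filter]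

lemma measurable_observation (G : SimpleGraph (Fin K)) :
    Measurable fun p : Fin K × RewardVec K => observation G p.1 p.2 := by
  classical
  refine measurable_from_prod_countable_right fun i => ?_
  refine measurable_const.prodMk (measurable_pi_lambda _ fun a => ?_)
  by_cases h : a = i ∨ G.Adj i a
  · simpa [observation, h] using measurable_pi_apply a
  · simp [h]

lemma history_le (hY : ∀ t, Measurable (Y t)) (hA : ∀ t, Measurable (A t)) (t : ℕ) :
    history G Y A t ≤ ‹MeasurableSpace Ω› := by
  refine iSup₂_le fun s _ => Measurable.comap_le ?_
  exact (measurable_observation (G s)).comp ((hA s).prodMk (hY s))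

lemma essBdd_revealInd_history (t : ℕ) (a : Fin K) :
    EssBdd (history G Y A (t + 1)) P (revealInd (G t) (A t) a) := by
  have hA : Measurable[history G Y A (t + 1)] (A t) :=
    measurable_fst.comp (measurable_observation_history t)
  have h := essBdd_nbhdWeight (P := P) (G t) (fun i => essBdd_eventInd hA i) a
  simpa only [← revealInd_eq_nbhdWeight] using h

lemma essBdd_revealInd_mul_reward_history (t : ℕ) (a : Fin K) :
    EssBdd (history G Y A (t + 1)) P fun ω => revealInd (G t) (A t) a ω * reward Y t a ω := by
  classical
  have e : (fun ω => revealInd (G t) (A t) a ω * reward Y t a ω) =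
      fun ω => (((observation (G t) (A t ω) (Y t ω)).2 a : unitInterval) : ℝ) := by
    ext ω
    by_cases h : a = A t ω ∨ (G t).Adj (A t ω) a <;> simp [revealInd, reward, observation, h]
  rw [e]
  refine .of_mem_Icc (C := 1) (Measurable.stronglyMeasurable ?_) (fun ω => unitInterval.nonneg _)
    fun ω => unitInterval.le_one _
  exact measurable_subtype_coe.comp ((measurable_pi_apply a).comp
    (measurable_snd.comp (measurable_observation_history t)))

lemma essBdd_reward_environment (t : ℕ) (a : Fin K) :
    EssBdd (environment G pstar Y A t) P (reward Y t a) := by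
  refine .of_mem_Icc (C := 1) (Measurable.stronglyMeasurable ?_) (fun ω => unitInterval.nonneg _)
    fun ω => unitInterval.le_one _
  have h : Measurable[environment G pstar Y A t] fun ω s => Y s ω :=
    measurable_iff_comap_le.2 le_sup_right
  exact measurable_subtype_coe.comp ((measurable_pi_apply a).comp ((measurable_pi_apply t).comp h))

lemma IsBayesianBandit.essBdd_eventInd_environment (hb : IsBayesianBandit P pstar Y Astar)
    (t : ℕ) (a : Fin K) : EssBdd (environment G pstar Y A t) P (eventInd Astar a) :=
  have h : MeasurableSpace.comap pstar inferInstance ≤ environment G pstar Y A t :=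
    le_sup_of_le_left le_sup_right
  essBdd_eventInd (hb.measurable_Astar.mono h le_rfl) a

lemma IsBayesianBandit.environment_le (hb : IsBayesianBandit P pstar Y Astar)
    (hA : ∀ t, Measurable (A t)) (t : ℕ) : environment G pstar Y A t ≤ ‹MeasurableSpace Ω› :=
  sup_le (sup_le (history_le hb.measurable_Y hA t) hb.measurable_pstar.comap_le)
    (measurable_pi_lambda _ fun s => hb.measurable_Y s).comap_le

/-- The summand `q α Δ²` of the information bound for round `t`: `q` is the probability that the
reward of `a` is revealed, `α` the posterior probability of `Astar = a`, and `Δ` the shift of the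
conditional mean of that reward caused by learning that `Astar = a`. -/
noncomputable def roundInfo (P : Measure Ω) (G : ℕ → SimpleGraph (Fin K))
    (Y : ℕ → Ω → RewardVec K) (A : ℕ → Ω → Fin K) (Astar : Ω → Fin K) (t : ℕ) (a : Fin K)
    (ω : Ω) : ℝ :=
  nbhdWeight (G t) (fun i => sampling P G Y A t i ω) a * optPosterior P G Y A Astar t a ω *
    meanShift (history G Y A t) P (eventInd Astar a) (reward Y t a) ω ^ 2

/-- Minus the expected entropy of the posterior of `Astar` before round `t`. -/
noncomputable def negPosteriorEntropy (P : Measure Ω) (G : ℕ → SimpleGraph (Fin K))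
    (Y : ℕ → Ω → RewardVec K) (A : ℕ → Ω → Fin K) (Astar : Ω → Fin K) (t : ℕ) : ℝ :=
  ∑ a, ∫ ω, optPosterior P G Y A Astar t a ω * Real.log (optPosterior P G Y A Astar t a ω) ∂P

lemma essBdd_sampling (hA : ∀ t, Measurable (A t)) (t : ℕ) (a : Fin K) :
    EssBdd (history G Y A t) P (sampling P G Y A t a) :=
  (essBdd_eventInd (P := P) (hA t) a).condExp

lemma IsBayesianBandit.essBdd_optPosterior (hb : IsBayesianBandit P pstar Y Astar) (t : ℕ)
    (a : Fin K) : EssBdd (history G Y A t) P (optPosterior P G Y A Astar t a) :=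
  (hb.essBdd_eventInd_environment (G := G) (A := A) t a).condExp

section round

variable [IsProbabilityMeasure P]

lemma IsBayesianBandit.essBdd_meanShift (hb : IsBayesianBandit P pstar Y Astar)
    (hA : ∀ t, Measurable (A t)) (t : ℕ) (a : Fin K) :
    EssBdd (history G Y A t) P
      (meanShift (history G Y A t) P (eventInd Astar a) (reward Y t a)) :=
  GraphBandit.essBdd_meanShift (history_le hb.measurable_Y hA t)
    ((hb.essBdd_eventInd_environment (G := G) (A := A) t a).mono (hb.environment_le hA t))
    (eventInd_nonneg _ _)
    ((essBdd_reward_environment (G := G) (pstar := pstar) (A := A) t a).mono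
      (hb.environment_le hA t))
    (fun _ => unitInterval.nonneg _) (fun _ => unitInterval.le_one _)

lemma essBdd_roundInfo (hb : IsBayesianBandit P pstar Y Astar)
    (hA : ∀ t, Measurable (A t)) (t : ℕ) (a : Fin K) :
    EssBdd (history G Y A t) P (roundInfo P G Y A Astar t a) :=
  ((essBdd_nbhdWeight (G t) (essBdd_sampling hA t) a).mul (hb.essBdd_optPosterior t a)).mul
    ((hb.essBdd_meanShift hA t a).comp (φ := fun x => x ^ 2) (by fun_prop))

/-- The expected posterior entropy drops in round `t` by at least twice the sum of the `q α Δ²`.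
For each value `a` of `Astar` only the reward of `a` itself is used, so dependence between the
rewards of different actions plays no role. -/
theorem two_mul_integral_roundInfo_le (hb : IsBayesianBandit P pstar Y Astar)
    (hp : IsRandomizedPolicy P G pstar Y A) (t : ℕ) :
    2 * ∫ ω, ∑ a, roundInfo P G Y A Astar t a ω ∂P ≤
      negPosteriorEntropy P G Y A Astar (t + 1) - negPosteriorEntropy P G Y A Astar t := by
  classical
  rw [integral_finsetSum _ fun a _ => (essBdd_roundInfo hb hp.measurable_A t a).integrable
    (history_le hb.measurable_Y hp.measurable_A t), negPosteriorEntropy, negPosteriorEntropy,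
    ← Finset.sum_sub_distrib, Finset.mul_sum]
  refine Finset.sum_le_sum fun a _ => le_sub_iff_add_le'.2 ?_
  refine integral_mul_log_condExp_add_le (M := environment G pstar Y A t) (history_le_succ t)
    (history_le hb.measurable_Y hp.measurable_A _) (history_le_environment t)
    (hb.environment_le hp.measurable_A t) (hb.essBdd_eventInd_environment t a)
    (eventInd_nonneg _ _) (essBdd_reward_environment t a)
    (fun _ => unitInterval.nonneg _) (fun _ => unitInterval.le_one _)
    (essBdd_revealInd_history t a) (fun ω => ?_) (essBdd_revealInd_mul_reward_history t a)
    (essBdd_nbhdWeight (G t) (essBdd_sampling hp.measurable_A t) a) ?_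
  · unfold revealInd; split_ifs <;> simp
  · have h := condExp_nbhdWeight (P := P) (m := environment G pstar Y A t) (G t)
      (fun i => (essBdd_eventInd (P := P) (hp.measurable_A t) i).integrable le_rfl) a
    simp only [← revealInd_eq_nbhdWeight] at h
    have h2 : ∀ᵐ ω ∂P, ∀ i, (P[eventInd (A t) i|environment G pstar Y A t]) ω =
        sampling P G Y A t i ω := ae_all_iff.2 fun i => hp.nonanticipating t i
    filter_upwards [h, h2] with ω h h2
    rw [h]
    simp only [h2]

/-- Since the action is drawn from the posterior of `Astar`, it matches `Astar` in conditional law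
but not in its dependence on the rewards, so only the shifts of the conditional means remain. -/
theorem integral_instant_regret_eq (hb : IsBayesianBandit P pstar Y Astar)
    (hp : IsTSN P G pstar Y Astar A) (t : ℕ) :
    ∫ ω, ((Y t ω (Astar ω) : ℝ) - (Y t ω (A t ω) : ℝ)) ∂P =
      ∫ ω, ∑ a, optPosterior P G Y A Astar t a ω *
        meanShift (history G Y A t) P (eventInd Astar a) (reward Y t a) ω ∂P := by
  have hA := hp.measurable_A
  have hF := history_le (G := G) hb.measurable_Y hA t
  have hM := hb.environment_le (G := G) hA t
  have hFM := history_le_environment (G := G) (pstar := pstar) (Y := Y) (A := A) t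
  have hV := hb.essBdd_eventInd_environment (G := G) (A := A) t
  have hR := essBdd_reward_environment (P := P) (G := G) (pstar := pstar) (Y := Y) (A := A) t
  have hU := fun a => essBdd_eventInd (P := P) (hA t) a
  have hα := hb.essBdd_optPosterior (G := G) (A := A) t
  have hVR := fun a => (hV a).mul (hR a)
  have e : ∀ ω, (Y t ω (Astar ω) : ℝ) - (Y t ω (A t ω) : ℝ) =
      ∑ a, (eventInd Astar a ω * reward Y t a ω - eventInd (A t) a ω * reward Y t a ω) :=
    fun ω => by
      rw [Finset.sum_sub_distrib, sum_eventInd_mul Astar fun a => reward Y t a ω,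
        sum_eventInd_mul (A t) fun a => reward Y t a ω]
      rfl
  simp only [e]
  rw [integral_finsetSum _ fun a _ =>
      (((hVR a).mono hM).sub ((hU a).mul ((hR a).mono hM))).integrable le_rfl,
    integral_finsetSum _ fun a _ => ((hα a).mul (hb.essBdd_meanShift hA t a)).integrable hF]
  refine Finset.sum_congr rfl fun a _ => ?_
  rw [integral_sub ((hVR a).integrable hM) (((hU a).mul ((hR a).mono hM)).integrable le_rfl)]
  have h1 := integral_mul_mul_of_condExp_eq hFM hM (hU a) (essBdd_sampling hA t a)
    (hp.nonanticipating t a) (EssBdd.const _ P 1) (hR a)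
  simp only [one_mul] at h1
  rw [h1, ← integral_condExp hF, ← integral_sub ((hVR a).condExp.integrable hF)
    (((essBdd_sampling hA t a).mul (hR a).condExp).integrable hF)]
  refine integral_congr_ae ?_
  filter_upwards [hp.sampling_eq_posterior t a, condExp_mul_meanShift hF ((hV a).mono hM)
    (eventInd_nonneg _ _) ((hR a).mono hM) (fun _ => unitInterval.nonneg _)
    (fun _ => unitInterval.le_one _)] with ω h2 h3
  rw [h2]
  exact h3.symm

/-- The information-ratio bound: the squared expected regret of a round is at most the independence
number times the expected sum of the `q α Δ²`. -/
theorem sq_integral_instant_regret_le (hb : IsBayesianBandit P pstar Y Astar)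
    (hp : IsTSN P G pstar Y Astar A) (t : ℕ) :
    (∫ ω, ((Y t ω (Astar ω) : ℝ) - (Y t ω (A t ω) : ℝ)) ∂P) ^ 2 ≤
      ((G t).indepNum : ℝ) * ∫ ω, ∑ a, roundInfo P G Y A Astar t a ω ∂P := by
  have hA := hp.measurable_A
  have hF := history_le (G := G) hb.measurable_Y hA t
  have hX : EssBdd (history G Y A t) P fun ω => ∑ a, optPosterior P G Y A Astar t a ω *
      meanShift (history G Y A t) P (eventInd Astar a) (reward Y t a) ω :=
    EssBdd.sum fun a _ => (hb.essBdd_optPosterior t a).mul (hb.essBdd_meanShift hA t a)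
  have hX2 := hX.comp (φ := fun x => x ^ 2) (by fun_prop)
  rw [integral_instant_regret_eq hb hp t]
  have hjensen := (Even.convexOn_pow (𝕜 := ℝ) even_two).map_integral_le (by fun_prop) isClosed_univ
    (.of_forall fun _ => Set.mem_univ _) (hX.integrable hF) (hX2.integrable hF)
  refine hjensen.trans ?_
  rw [← integral_const_mul]
  refine integral_mono_ae (hX2.integrable hF) (((EssBdd.sum fun a _ =>
    essBdd_roundInfo hb hA t a).const_mul _).integrable hF) ?_
  have h1 : ∀ᵐ ω ∂P, ∀ a, sampling P G Y A t a ω = optPosterior P G Y A Astar t a ω :=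
    ae_all_iff.2 fun a => hp.sampling_eq_posterior t a
  have h2 : ∀ᵐ ω ∂P, ∀ a, 0 ≤ optPosterior P G Y A Astar t a ω :=
    ae_all_iff.2 fun a => condExp_nonneg (.of_forall (eventInd_nonneg Astar a))
  filter_upwards [h1, h2] with ω h1 h2
  simp only [roundInfo, h1]
  exact sq_sum_mul_le_indepNum_mul (G t) h2 _

end round

/-! ### Summation over the rounds -/

lemma negPosteriorEntropy_zero [IsProbabilityMeasure P]
    (hb : IsBayesianBandit P pstar Y Astar) :
    negPosteriorEntropy P G Y A Astar 0 = -entropy (optPrior P Astar) := by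
  have hm : Measurable Astar :=
    hb.measurable_Astar.mono hb.measurable_pstar.comap_le le_rfl
  have h : ∀ a, optPosterior P G Y A Astar 0 a = fun _ => optPrior P Astar a := fun a => by
    rw [optPosterior, history_zero, condExp_bot]
    ext
    rw [integral_indicator (hm (measurableSet_singleton a))]
    simp [optPrior]
  simp [negPosteriorEntropy, h, entropy]

lemma negPosteriorEntropy_nonpos [IsProbabilityMeasure P]
    (hb : IsBayesianBandit P pstar Y Astar) (hA : ∀ t, Measurable (A t)) (t : ℕ) :
    negPosteriorEntropy P G Y A Astar t ≤ 0 := by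
  refine Finset.sum_nonpos fun a _ => integral_nonpos_of_ae ?_
  filter_upwards [condExp_mem_Icc (P := P) (history_le (G := G) hb.measurable_Y hA t)
    ((hb.essBdd_eventInd_environment (G := G) (A := A) t a).integrable (hb.environment_le hA t))
    (eventInd_nonneg _ _) (eventInd_le_one _ _)] with ω h
  exact Real.mul_log_nonpos h.1 h.2

lemma sum_optPrior [IsProbabilityMeasure P] (hm : Measurable Astar) :
    ∑ a, optPrior P Astar a = 1 := by
  simp only [optPrior]
  rw [← measureReal_biUnion_finset]
  · rw [show (⋃ b ∈ (Finset.univ : Finset (Fin K)), Astar ⁻¹' {b}) = Set.univ by ext; simp]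
    simp
  · exact fun a _ b _ hab => Set.disjoint_left.2 fun ω h1 h2 => hab (h1.symm.trans h2)
  · exact fun a _ => hm (measurableSet_singleton a)

lemma integrable_instant_regret [IsProbabilityMeasure P] (hY : ∀ t, Measurable (Y t))
    (hm : Measurable Astar) (hA : ∀ t, Measurable (A t)) (t : ℕ) :
    Integrable (fun ω => (Y t ω (Astar ω) : ℝ) - (Y t ω (A t ω) : ℝ)) P := by
  have key : ∀ X : Ω → Fin K, Measurable X → Integrable (fun ω => (Y t ω (X ω) : ℝ)) P := by
    intro X hX
    refine (EssBdd.of_mem_Icc (P := P) (C := 1) (Measurable.stronglyMeasurable ?_)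
      (fun ω => unitInterval.nonneg _) fun ω => unitInterval.le_one _).integrable le_rfl
    have h : Measurable fun p : Fin K × RewardVec K => (p.2 p.1 : ℝ) :=
      measurable_from_prod_countable_right fun i =>
        measurable_subtype_coe.comp (measurable_pi_apply i)
    exact h.comp (hX.prodMk (hY t))
  exact (key _ hm).sub (key _ (hA t))

theorem integral_regret_le [IsProbabilityMeasure P] (hb : IsBayesianBandit P pstar Y Astar)
    (hp : IsTSN P G pstar Y Astar A) (T : ℕ) :
    ∫ ω, regret Y Astar A T ω ∂P ≤
      √(1 / 2 * (∑ t ∈ Finset.range T, ((G t).indepNum : ℝ)) * entropy (optPrior P Astar)) := by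
  have hm : Measurable Astar := hb.measurable_Astar.mono hb.measurable_pstar.comap_le le_rfl
  have hinfo := two_mul_integral_roundInfo_le hb hp.toIsRandomizedPolicy
  have hinfo0 : ∀ t, 0 ≤ ∫ ω, ∑ a, roundInfo P G Y A Astar t a ω ∂P := fun t => by
    refine integral_nonneg_of_ae ?_
    have h1 : ∀ᵐ ω ∂P, ∀ a, 0 ≤ sampling P G Y A t a ω :=
      ae_all_iff.2 fun a => condExp_nonneg (.of_forall (eventInd_nonneg (A t) a))
    have h2 : ∀ᵐ ω ∂P, ∀ a, 0 ≤ optPosterior P G Y A Astar t a ω :=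
      ae_all_iff.2 fun a => condExp_nonneg (.of_forall (eventInd_nonneg Astar a))
    filter_upwards [h1, h2] with ω h1 h2
    exact Finset.sum_nonneg fun a _ => mul_nonneg (mul_nonneg
      ((h1 a).trans (le_nbhdWeight (G t) h1 (Or.inl rfl))) (h2 a)) (sq_nonneg _)
  simp only [regret]
  rw [integral_finsetSum _ fun t _ =>
    integrable_instant_regret hb.measurable_Y hm hp.measurable_A t]
  -- Cauchy–Schwarz over the rounds.
  refine Real.le_sqrt_of_sq_le ((Finset.sum_sq_le_sum_mul_sum_of_sq_le_mul (Finset.range T)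
    (f := fun t => ((G t).indepNum : ℝ)) (fun t _ => Nat.cast_nonneg _) (fun t _ => hinfo0 t)
    fun t _ => sq_integral_instant_regret_le hb hp t).trans ?_)
  -- The entropy drops telescope from the prior entropy.
  have htel : ∑ t ∈ Finset.range T, ∫ ω, ∑ a, roundInfo P G Y A Astar t a ω ∂P ≤
      1 / 2 * entropy (optPrior P Astar) := by
    have h1 := Finset.sum_le_sum fun t (_ : t ∈ Finset.range T) => hinfo t
    rw [← Finset.mul_sum, Finset.sum_range_sub, negPosteriorEntropy_zero hb] at h1
    have h2 := negPosteriorEntropy_nonpos (G := G) hb hp.measurable_A T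
    linarith
  refine (mul_le_mul_of_nonneg_left htel
    (Finset.sum_nonneg fun t _ => Nat.cast_nonneg _)).trans (le_of_eq ?_)
  ring

end GraphBandit

theorem mainTheorem1 {Ω : Type*} [MeasurableSpace Ω] (P : Measure Ω) [IsProbabilityMeasure P]
    {K : ℕ} (G : ℕ → SimpleGraph (Fin K))
    (pstar : Ω → ProbabilityMeasure (GraphBandit.RewardVec K))
    (Y : ℕ → Ω → GraphBandit.RewardVec K) (Astar : Ω → Fin K) (A : ℕ → Ω → Fin K)
    (hbandit : GraphBandit.IsBayesianBandit P pstar Y Astar)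
    (hTSN : GraphBandit.IsTSN P G pstar Y Astar A) (T : ℕ) :
    Integrable (GraphBandit.regret Y Astar A T) P ∧
    ∫ ω, GraphBandit.regret Y Astar A T ω ∂P ≤
      √(1 / 2 * (∑ t ∈ Finset.range T, ((G t).indepNum : ℝ)) *
        GraphBandit.entropy (GraphBandit.optPrior P Astar)) ∧
    GraphBandit.entropy (GraphBandit.optPrior P Astar) ≤ Real.log K ∧
    ∫ ω, GraphBandit.regret Y Astar A T ω ∂P ≤
      √(1 / 2 * (GraphBandit.avgIndepNum G T * T * Real.log K)) := by
  have hm : Measurable Astar :=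
    hbandit.measurable_Astar.mono hbandit.measurable_pstar.comap_le le_rfl
  have hreg := GraphBandit.integral_regret_le hbandit hTSN T
  have hent : GraphBandit.entropy (GraphBandit.optPrior P Astar) ≤ Real.log K :=
    GraphBandit.entropy_le_log_card (fun _ => measureReal_nonneg) (GraphBandit.sum_optPrior hm)
  refine ⟨?_, hreg, hent, hreg.trans (Real.sqrt_le_sqrt ?_)⟩
  · exact integrable_finsetSum _ fun t _ =>
      GraphBandit.integrable_instant_regret hbandit.measurable_Y hm hTSN.measurable_A t
  · have havg : GraphBandit.avgIndepNum G T * T =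
        ∑ t ∈ Finset.range T, ((G t).indepNum : ℝ) := by
      rcases T.eq_zero_or_pos with rfl | hT
      · simp
      · exact div_mul_cancel₀ _ (by positivity)
    rw [havg, mul_assoc]
    gcongr
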